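/- **Setting.** Let $n,k\ge 1$, let $E\neq\emptyset$ be a set of $k$-element subsets $e=\{i_1<\dots<i_k\}$ of $[n]$, and let $\mathbb F$ be a finite field (or, more generally, a finite commutative ring). Fix a fixed-precision representation: a real $h>0$, a map $\mathsf{int}:\mathbb F\to\mathbb Z$, and a map $\mathsf{conv}:\mathbb Z\to\mathbb F$ with $\mathsf{conv}(\mathsf{int}(a))=a$; the element $a$ represents the number $\bar a=h\cdot\mathsf{int}(a)$. Let $c=\mathsf{conv}(|E|)$ and assume that $c$ is invertible in $\mathbb F$. Let $f:\mathbb F^k\to\mathbb F$ be any function, and let $\epsilon>0$, $\delta\ge 0$, $s\in\mathbb R$. For a finite set $I\ne\emptyset$ of players, $\mathsf{Share}(|I|,|I|,x)$ is a uniformly random vector in $\mathbb F^I$ with sum $x$, and $\mathsf{Rec}$ is the sum. **Protocol $\Pi_{\text{U-MPC}}$ in the $(\mathcal F_f,\mathcal F_{\text{noise}})$-hybrid model**, with inputs $x_1,\dots,x_n\in\mathbb F$. (1) For all $e\in E$ and $j\in[k]$, party $i_j$ shares $x_{i_j}$ by $\mathsf{Share}(k,k,\cdot)$ among the parties of $e$.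 (2) For every $e\in E$, $\mathcal F_f$ reconstructs the inputs from the shares of the parties of $e$ and gives these parties fresh $(k,k)$-shares of $f(x_{i_1},\dots,x_{i_k})$; party $i$ adds up its shares over all $e\ni i$, which gives $y_i$. (3) $\mathcal F_{\text{noise}}$ draws a real $\eta$ from $\mathrm{Lap}(0,s/\epsilon)$ if $\delta=0$ and from $\mathrm{Gauss}(0,2\ln(1.25/\delta)s^2/\epsilon^2)$ if $\delta>0$, rounds it to the nearest multiple $mh$ of $h$, and gives the parties $(n,n)$-shares $\eta_1,\dots,\eta_n$ of $\mathsf{conv}(m)$. (4) Party $i$ sends $z_i=y_i+c\,\eta_i$ to the aggregator, which outputs $\hat U=c^{-1}\mathsf{Rec}(z_1,\dots,z_n)\in\mathbb F$. (A scale or variance that is not positive is read as noise $0$.) The ideal functionality receives $x_1,\dots,x_n$, draws the converted noise $\mathsf{conv}(m)$ in the same way, and gives $c^{-1}\sum_{e\in E}f(x_e)+\mathsf{conv}(m)$ to the aggregator, where $x_e=(x_{i_1},\dots,x_{i_k})$. A static semi-honest adversary $\mathcal A$ fixes in advance a set $C\subseteq[n]$ of at most $n-1$ corrupted parties and whether the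 aggregator is corrupted as well. All parties follow the protocol. $\mathcal A$ outputs a randomized function of its view, which consists of the inputs of the corrupted parties, all shares that they send or receive, their messages $z_i$, and all $z_1,\dots,z_n$ if the aggregator is corrupted. An environment chooses the inputs and an internal state at random, and finally outputs a random bit depending on its state, the output of the aggregator and the output of $\mathcal A$. The simulator is given the inputs of the parties in $C$ and, if the aggregator is corrupted, the output $u$ of the ideal functionality. It makes $(k,k)$-shares of the true inputs of corrupted parties and of fresh uniform values in place of the inputs of honest parties, for each edge separately; it makes $(k,k)$-shares of $v_e=f(x_e)$ for each edge $e$ inside $C$, and of a fresh uniform value $v_e$ for each other edge; it makes $(n,n)$-shares of $u-c^{-1}\sum_{e}v_e$ if the aggregator is corrupted, and of a fresh uniform value otherwise; it computes all $z_i$ from these shares as in the protocol, and runs $\mathcal A$ on the resulting view. **Statement.** (a) *Security.* For every static semi-honest adversary and every environment, the output bit of the environment has exactly the same distribution in the execution of $\Pi_{\text{U-MPC}}$ and in the execution of the ideal functionality with the above simulator. (b) *Privacy.* Let $\mathbb X\subseteq\mathbb F$ be the instance space, let $\bar f(x)=\overline{f(x)}$, and let $U_{f,E}(x)=\frac1{|E|}\sum_{e\in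 E}\bar f(x_e)\in\mathbb R$. Assume that $\mathsf{conv}(m)=m\cdot 1_{\mathbb F}$ for all $m\in\mathbb Z$; that $U_{f,E}(x)\in h\mathbb Z$ for all $x\in\mathbb X^n$; that $s$ is at least the sensitivity of $\bar f$ on $\mathbb X^k$, or at least the sensitivity of $U_{f,E}$ on $\mathbb X^n$ (the sensitivity is the largest change of the value between two tuples that differ in at most one entry); and that $\epsilon\le 1$ if $\delta>0$. Then the output of $\Pi_{\text{U-MPC}}$ satisfies central $(\epsilon,\delta)$-differential privacy: for all $x,x'\in\mathbb X^n$ that differ in at most one entry and all $O\subseteq\mathbb F$, $$\Pr[\hat U(x)\in O]\le e^{\epsilon}\Pr[\hat U(x')\in O]+\delta .$$ -/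

import Mathlib

open MeasureTheory ProbabilityTheory
open scoped ENNReal NNReal BigOperators

namespace UMPC

noncomputable section

/-! ### Generic probability: independent sampling -/

/-- The joint law of a finite family of independent random variables with laws `p i`. -/
def indep {ι : Type} [Fintype ι] {α : ι → Type} [∀ i, Fintype (α i)]
    (p : ∀ i, PMF (α i)) : PMF (∀ i, α i) := by
  classical
  exact PMF.ofFintype (fun a => ∏ i, p i (a i)) (by
    have h := Finset.prod_univ_sum (fun i => (Finset.univ : Finset (α i))) (fun i x => p i x)
    rw [Fintype.piFinset_univ] at h
    rw [← h]
    refine Finset.prod_eq_one fun i _ => ?_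
    rw [← tsum_fintype (L := .unconditional _)]
    exact (p i).tsum_coe)

/-! ### Noise distributions -/

/-- The Laplace distribution with mean `0` and scale `b`, with density
`exp (-|t| / b) / (2 b)`; for scale `0` it is the point mass at `0`. -/
def laplace (b : ℝ) : Measure ℝ :=
  if 0 < b then
    (volume : Measure ℝ).withDensity fun t => ENNReal.ofReal (Real.exp (-|t| / b) / (2 * b))
  else Measure.dirac 0

/-- The noise law selected by the noise functionality: `Lap(0, s/ε)` if `δ = 0`, and
otherwise the centred Gaussian of variance `2 ln(1.25/δ) s² / ε²`. -/
def noiseLaw (ε δ s : ℝ) : Measure ℝ :=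
  if δ = 0 then laplace (s / ε)
  else gaussianReal 0 (2 * Real.log (1.25 / δ) * s ^ 2 / ε ^ 2).toNNReal

instance isProbabilityMeasure_laplace (b : ℝ) : IsProbabilityMeasure (laplace b) := by
  unfold laplace
  split_ifs with hb
  · constructor
    rw [withDensity_apply _ MeasurableSet.univ, Measure.restrict_univ]
    have hI : ∫ x in Set.Ioi (0 : ℝ), Real.exp (-x / b) = b := by
      have h1 := integral_exp_mul_Ioi (a := -b⁻¹) (by simpa using hb) 0
      have h2 : (fun x : ℝ => Real.exp (-x / b)) = fun x => Real.exp (-b⁻¹ * x) := by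
        funext x; congr 1; field_simp
      rw [h2, h1]; simp
    have hInt0 : IntegrableOn (fun x : ℝ => Real.exp (-x / b)) (Set.Ioi 0) := by
      have h1 := integrableOn_exp_mul_Ioi (a := -b⁻¹) (by simpa using hb) 0
      have h2 : (fun x : ℝ => Real.exp (-x / b)) = fun x => Real.exp (-b⁻¹ * x) := by
        funext x; congr 1; field_simp
      rwa [h2]
    have hint : ∫ x : ℝ, Real.exp (-|x| / b) = 2 * b := by
      rw [integral_comp_abs (f := fun x => Real.exp (-x / b)), hI]
    have hintg : Integrable (fun x : ℝ => Real.exp (-|x| / b)) := by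
      by_contra hcon
      rw [integral_undef hcon] at hint
      linarith
    rw [← ofReal_integral_eq_lintegral_ofReal (hintg.div_const _)
      (Filter.Eventually.of_forall fun x => by positivity), integral_div, hint,
      div_self (by positivity), ENNReal.ofReal_one]
  · infer_instance

instance isProbabilityMeasure_noiseLaw (ε δ s : ℝ) :
    IsProbabilityMeasure (noiseLaw ε δ s) := by
  unfold noiseLaw
  split_ifs <;> infer_instance

/-! ### Fixed-precision representation of numbers by elements of the share domain -/

/-- A fixed-precision representation: `a : F` represents the number `h * toInt a`, and
`ofInt m` is the element that represents `m * h` (with wrap-around if out of range). -/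
structure FixedPrecision (F : Type) where
  h : ℝ
  h_pos : 0 < h
  toInt : F → ℤ
  ofInt : ℤ → F
  ofInt_toInt : ∀ a, ofInt (toInt a) = a

/-- The number represented by `a`. -/
def FixedPrecision.value {F : Type} (R : FixedPrecision F) (a : F) : ℝ := R.h * (R.toInt a : ℝ)

theorem measurable_round_div (h : ℝ) : Measurable fun t : ℝ => round (t / h) := by
  simp only [round_eq]
  exact Int.measurable_floor.comp ((measurable_id.div_const h).add_const _)

/-- The law of the noise as an element of `F`: a real number is drawn from `noiseLaw ε δ s`,
rounded to the nearest multiple of `h`, and converted. -/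
def encodedNoise {F : Type} (R : FixedPrecision F) (ε δ s : ℝ) : PMF F :=
  haveI : IsProbabilityMeasure ((noiseLaw ε δ s).map fun t => round (t / R.h)) :=
    Measure.isProbabilityMeasure_map (measurable_round_div R.h).aemeasurable
  ((noiseLaw ε δ s).map fun t => round (t / R.h)).toPMF.map R.ofInt

/-! ### Additive secret sharing -/

section Sharing

variable {F : Type} [CommRing F] [Fintype F]

open Classical in
/-- Additive all-or-nothing secret sharing among the players `ι` (threshold `|ι|` out of
`|ι|`): a uniformly random vector of shares whose sum is the secret. -/
def share (ι : Type) [Fintype ι] [Nonempty ι] (x : F) : PMF (ι → F) :=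
  PMF.uniformOfFinset (Finset.univ.filter fun v : ι → F => ∑ i, v i = x)
    ⟨Pi.single (Classical.arbitrary ι) x, by simp⟩

/-- Reconstruction from all shares. -/
def reconstruct {ι : Type} [Fintype ι] (v : ι → F) : F := ∑ i, v i

end Sharing

/-! ### Datasets, sensitivity, differential privacy -/

/-- Datasets of the same size that differ in at most one instance. -/
def Adjacent {m : ℕ} {X : Type} (x x' : Fin m → X) : Prop :=
  x = x' ∨ ∃ i, ∀ j, j ≠ i → x j = x' j

/-- The sensitivity of a real-valued query on datasets with instances in `D`. -/
def sensitivity {m : ℕ} {X : Type} (D : Set X) (g : (Fin m → X) → ℝ) : ℝ :=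
  sSup {r | ∃ x x' : Fin m → X, (∀ i, x i ∈ D) ∧ (∀ i, x' i ∈ D) ∧ Adjacent x x' ∧
    r = |g x - g x'|}

/-- Central `(ε, δ)`-differential privacy of a randomized algorithm on datasets with
instances in `D`. -/
def IsCentralDP {m : ℕ} {X β : Type} (D : Set X) (M : (Fin m → X) → PMF β) (ε δ : ℝ) : Prop :=
  ∀ x x' : Fin m → X, (∀ i, x i ∈ D) → (∀ i, x' i ∈ D) → Adjacent x x' →
    ∀ O : Set β, (M x).toOuterMeasure O ≤
      ENNReal.ofReal (Real.exp ε) * (M x').toOuterMeasure O + ENNReal.ofReal δ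

/-! ### The protocol in the hybrid model -/

/-- Possible hyperedges: sets of `k` distinct elements of `[n]`, listed in increasing order. -/
abbrev Edge (n k : ℕ) : Type := Fin k ↪o Fin n

/-- Public parameters: the `k`-uniform hypergraph `E`, the kernel `f` on the share domain, the
fixed-precision representation, the privacy parameters, and the noise sensitivity `s`. -/
structure Params (F : Type) (n k : ℕ) where
  E : Finset (Edge n k)
  f : (Fin k → F) → F
  R : FixedPrecision F
  ε : ℝ
  δ : ℝ
  s : ℝ

section Protocol

variable {F : Type} [CommRing F] [Fintype F] {n k : ℕ} [NeZero n] [NeZero k]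

/-- The public constant `|E|` as an element of `F`. -/
def Params.card (P : Params F n k) : F := P.R.ofInt (P.E.card : ℤ)

/-- The real-valued kernel represented by `f`. -/
def Params.kernel (P : Params F n k) (x : Fin k → F) : ℝ := P.R.value (P.f x)

/-- The real-valued incomplete U-statistic. -/
def Params.uStat (P : Params F n k) (x : Fin n → F) : ℝ :=
  (∑ e ∈ P.E, P.kernel (fun j => x (e j))) / (P.E.card : ℝ)

/-- Ideal functionality for the kernel on one edge. `S l j` is the share, held by the `l`-th
party of the edge, of the input of the `j`-th party. -/
def functionalityF (f : (Fin k → F) → F) (S : Fin k → Fin k → F) : PMF (Fin k → F) :=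
  share (Fin k) (f fun j => reconstruct fun l => S l j)

/-- Ideal functionality for the noise: each of the `n` parties gets one share. -/
def functionalityNoise (n : ℕ) [NeZero n] (R : FixedPrecision F) (ε δ s : ℝ) :
    PMF (Fin n → F) := do
  let η ← encodedNoise R ε δ s
  share (Fin n) η

/-- Everything that is exchanged in one execution. -/
structure Transcript (P : Params F n k) where
  /-- `inputShare e j l` is sent by the `j`-th party of `e` to the `l`-th party of `e`. -/
  inputShare : P.E → Fin k → Fin k → F
  /-- `kernelShare e l` is received by the `l`-th party of `e` from the kernel functionality. -/
  kernelShare : P.E → Fin k → F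
  /-- `noiseShare i` is received by party `i` from the noise functionality. -/
  noiseShare : Fin n → F
  /-- `message i` is sent by party `i` to the aggregator. -/
  message : Fin n → F

/-- The sum `y_i` of the kernel shares that party `i` holds. -/
def localSum (P : Params F n k) (b : P.E → Fin k → F) (i : Fin n) : F :=
  ∑ e : P.E, ∑ l : Fin k, if e.1 l = i then b e l else 0

/-- The message `z_i = y_i + |E| η_i`. -/
def aggMessage (P : Params F n k) (b : P.E → Fin k → F) (η : Fin n → F) (i : Fin n) : F :=
  localSum P b i + P.card * η i

/-- The protocol, run on inputs `x`, in the hybrid model. -/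
def run (P : Params F n k) (x : Fin n → F) : PMF (Transcript P) := do
  let a ← indep fun e : P.E => indep fun j : Fin k => share (Fin k) (x (e.1 j))
  let b ← indep fun e : P.E => functionalityF P.f (fun l j => a e j l)
  let η ← functionalityNoise n P.R P.ε P.δ P.s
  pure { inputShare := a, kernelShare := b, noiseShare := η, message := aggMessage P b η }

/-- The output of the aggregator, `|E|⁻¹ Rec(z_1, …, z_n)`. -/
def output {P : Params F n k} (T : Transcript P) : F :=
  Ring.inverse P.card * reconstruct T.message

/-- The output law of the protocol. -/
def outputLaw (P : Params F n k) (x : Fin n → F) : PMF F := (run P x).map output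

/-- The ideal functionality that the protocol is to realize: it receives all inputs and gives
the noisy incomplete U-statistic, computed in `F`, to the aggregator. -/
def idealFunctionality (P : Params F n k) (x : Fin n → F) : PMF F := do
  let η ← encodedNoise P.R P.ε P.δ P.s
  pure (Ring.inverse P.card * (∑ e ∈ P.E, P.f fun j => x (e j)) + η)

/-! ### Adversaries, environments and simulation -/

/-- The view of the corrupted parties; `none` stands for what they do not see. -/
structure View (P : Params F n k) where
  input : Fin n → Option F
  inputShare : P.E → Fin k → Fin k → Option F
  kernelShare : P.E → Fin k → Option F
  noiseShare : Fin n → Option F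
  message : Fin n → Option F

/-- A static semi-honest adversary: it fixes in advance a set of corrupted parties, at most
`n - 1` of them, and whether the aggregator is corrupted too; corrupted parties follow the
protocol, and the adversary outputs a randomized function of their joint view. -/
structure Adversary (P : Params F n k) where
  corrupted : Finset (Fin n)
  card_le : corrupted.card ≤ n - 1
  aggregator : Bool
  Out : Type
  strategy : View P → PMF Out

variable {P : Params F n k}

/-- The inputs of the corrupted parties. -/
def Adversary.inputs (A : Adversary P) (x : Fin n → F) (i : Fin n) : Option F :=
  if i ∈ A.corrupted then some (x i) else none

/-- The part of a transcript that the adversary sees: all that a corrupted party sends or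
receives, and all messages to the aggregator if the latter is corrupted. -/
def Adversary.view (A : Adversary P) (c : Fin n → Option F) (T : Transcript P) : View P where
  input := c
  inputShare e j l :=
    if e.1 j ∈ A.corrupted ∨ e.1 l ∈ A.corrupted then some (T.inputShare e j l) else none
  kernelShare e l := if e.1 l ∈ A.corrupted then some (T.kernelShare e l) else none
  noiseShare i := if i ∈ A.corrupted then some (T.noiseShare i) else none
  message i :=
    if A.aggregator = true ∨ i ∈ A.corrupted then some (T.message i) else none

/-- An environment: it chooses the inputs of all parties, and finally guesses a bit from its
state, the output of the aggregator, and the output of the adversary. -/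
structure Environment (F : Type) (n : ℕ) (Out : Type) where
  State : Type
  init : PMF ((Fin n → F) × State)
  guess : State → F → Out → PMF Bool

/-- A simulator for `A`: from the inputs of the corrupted parties, and the output of the ideal
functionality if the aggregator is corrupted, it produces an output for `A`. -/
abbrev Simulator (A : Adversary P) : Type := (Fin n → Option F) → Option F → PMF A.Out

/-- The execution of the protocol with adversary `A` and environment `Z`. -/
def realExec (A : Adversary P) (Z : Environment F n A.Out) : PMF Bool := do
  let z ← Z.init
  let T ← run P z.1
  let o ← A.strategy (A.view (A.inputs z.1) T)
  Z.guess z.2 (output T) o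

/-- The execution of the ideal functionality with simulator `S` and environment `Z`. -/
def idealExec (A : Adversary P) (S : Simulator A) (Z : Environment F n A.Out) : PMF Bool := do
  let z ← Z.init
  let u ← idealFunctionality P z.1
  let o ← S (A.inputs z.1) (if A.aggregator = true then some u else none)
  Z.guess z.2 u o

/-- A known value, or a fresh uniform element of `F`. -/
def orUniform (c : Option F) : PMF F := c.elim (PMF.uniformOfFintype F) pure

/-- The simulated transcript. Every honest input on an edge is replaced by a fresh random
value, and so is the kernel value on each edge with an honest party; the noise shares are shares
of the noise that makes the output equal to `u` if `u` is known, and of a random value otherwise.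
The values are shared as in the protocol. -/
def simTranscript (P : Params F n k) (c : Fin n → Option F) (u : Option F) :
    PMF (Transcript P) := do
  let x ← indep fun e : P.E => indep fun j : Fin k => orUniform (c (e.1 j))
  let a ← indep fun e : P.E => indep fun j : Fin k => share (Fin k) (x e j)
  let y ← indep fun e : P.E =>
    orUniform (if ∀ j, (c (e.1 j)).isSome = true then some (P.f (x e)) else none)
  let b ← indep fun e : P.E => share (Fin k) (y e)
  let η₀ ← orUniform (u.map fun v => v - Ring.inverse P.card * ∑ e : P.E, y e)
  let η ← share (Fin n) η₀
  pure { inputShare := a, kernelShare := b, noiseShare := η, message := aggMessage P b η }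

/-- The simulator built from random shares: it runs `A` on the view of a simulated transcript. -/
def simulator (A : Adversary P) : Simulator A := fun c u => do
  let T ← simTranscript P c u
  A.strategy (A.view c T)

end Protocol

end

end UMPC

namespace UMPC

noncomputable section

set_option linter.unusedSectionVars false

/-! ### Independent sampling -/

section Indep

variable {ι : Type} [Fintype ι] {α β : ι → Type} [∀ i, Fintype (α i)] [∀ i, Fintype (β i)]

/-! Security. A vector of additive shares with one coordinate hidden has a law that does not depend
on the secret: translating the hidden coordinate carries one fibre of the sum onto another
(`share_map_eq`). An honest party keeps one share of its own input to itself, and on an edge with an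
honest party one kernel share stays unseen, so dummy secrets serve the simulator equally well. As
`P.card` is a unit, the messages `z = y + c η` form, given the kernel shares, a fresh sharing of `c
u`, where `u` is the output (`share_map_affine`), and the noise shares of corrupted parties can be
read off from `z` and `y`. Hence, given `u`, the view is built from independent masked sharings
(`viewLaw`), and the protocol and the simulator both produce this law (`run_bind_output_view`,
`simTranscript_bind_view`).

Privacy. The output has the law of the ideal functionality. When the statistic lies in `hℤ` and
conversion is the ring map from `ℤ`, rounding commutes with adding the statistic, so the output is a
post-processing of `U(x) + η` with real noise (`outputLaw_toOuterMeasure`). It remains to bound the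
effect of a shift by at most `s` on the Laplace and Gaussian laws (`noiseLaw_shift_le`). -/

theorem indep_apply (p : ∀ i, PMF (α i)) (a : ∀ i, α i) : indep p a = ∏ i, p i (a i) := rfl

/-- Distributivity of a finite product over sums. It reduces the comparison of whole executions to
single edges and single inputs. -/
theorem indep_bind (p : ∀ i, PMF (α i)) (q : ∀ i, α i → PMF (β i)) :
    ((indep p).bind fun a => indep fun i => q i (a i)) = indep fun i => (p i).bind (q i) := by
  classical
  ext b
  have h := Finset.prod_univ_sum (fun i => (Finset.univ : Finset (α i)))
    (fun i x => p i x * q i x (b i))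
  rw [Fintype.piFinset_univ] at h
  simp only [PMF.bind_apply, indep_apply, tsum_fintype, ← Finset.prod_mul_distrib]
  exact h.symm

theorem indep_pure (b : ∀ i, β i) : (indep fun i => PMF.pure (b i)) = PMF.pure b := by
  classical
  ext a
  simp only [indep_apply, PMF.pure_apply]
  by_cases h : a = b
  · simp [h]
  · obtain ⟨i, hi⟩ := Function.ne_iff.1 h
    rw [if_neg h]
    exact Finset.prod_eq_zero (Finset.mem_univ i) (by simp [hi])

theorem indep_map (p : ∀ i, PMF (α i)) (g : ∀ i, α i → β i) :
    (indep p).map (fun a i => g i (a i)) = indep fun i => (p i).map (g i) := by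
  simp only [PMF.map, ← indep_bind, Function.comp_def, indep_pure]

theorem mem_support_indep {p : ∀ i, PMF (α i)} {a : ∀ i, α i} :
    a ∈ (indep p).support ↔ ∀ i, a i ∈ (p i).support := by
  simp [PMF.mem_support_iff, indep_apply, Finset.prod_eq_zero_iff]

end Indep

/-- Allows almost sure facts, such as shares adding up to their secret, to be used inside a `bind`.
-/
theorem bind_congr_support {α β : Type} (p : PMF α) {f g : α → PMF β}
    (h : ∀ a ∈ p.support, f a = g a) : p.bind f = p.bind g := by
  ext b
  simp only [PMF.bind_apply]
  refine tsum_congr fun a => ?_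
  by_cases ha : a ∈ p.support
  · rw [h a ha]
  · rw [PMF.mem_support_iff, not_not] at ha
    simp [ha]

/-! ### Additive shares -/

section Sharing

variable {F : Type} [CommRing F] [Fintype F] {ι : Type} [Fintype ι] [Nonempty ι]

open Classical in
theorem share_apply (x : F) (v : ι → F) : share ι x v = if ∑ i, v i = x then
    ((Finset.univ.filter fun w : ι → F => ∑ i, w i = x).card : ℝ≥0∞)⁻¹ else 0 := by
  refine (PMF.uniformOfFinset_apply _ v).trans ?_
  simp

open Classical in
theorem mem_support_share {x : F} {v : ι → F} : v ∈ (share ι x).support ↔ ∑ i, v i = x :=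
  (PMF.mem_support_uniformOfFinset_iff _ v).trans (by simp)

open Classical in
-- The bijection matches the two fibres of the sum, so they have equal size and the uniform laws
-- correspond.
theorem share_map_equiv {x y : F} (g : (ι → F) ≃ (ι → F))
    (h : ∀ v, ∑ i, g v i = y ↔ ∑ i, v i = x) : (share ι x).map g = share ι y := by
  have hcard : (Finset.univ.filter fun v : ι → F => ∑ i, v i = x).card =
      (Finset.univ.filter fun v : ι → F => ∑ i, v i = y).card :=
    Finset.card_equiv g fun v => by simp [h]
  ext w
  rw [PMF.map_apply, tsum_eq_single (g.symm w)]
  · have := h (g.symm w)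
    simp only [Equiv.apply_symm_apply] at this
    simp [share_apply, hcard, this]
  · intro v hv
    rw [if_neg]
    rintro rfl
    simp at hv

/-- Shares hidden from at least one player carry no information on the secret. -/
theorem share_map_eq {β : Type} (x y : F) (i : ι) (g : (ι → F) → β)
    (hg : ∀ v w : ι → F, (∀ j, j ≠ i → v j = w j) → g v = g w) :
    (share ι x).map g = (share ι y).map g := by
  classical
  -- The translation moves only coordinate `i`, which `g` ignores.
  rw [← share_map_equiv (x := x) (y := y) (Equiv.addRight (Pi.single i (y - x))), PMF.map_comp]
  · congr 1
    funext v
    exact hg _ _ fun j hj => by simp [hj]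
  · intro v
    simp only [Equiv.coe_addRight, Pi.add_apply, Finset.sum_add_distrib, Finset.sum_pi_single',
      Finset.mem_univ, if_true]
    constructor
    · intro h; linear_combination h
    · intro h; linear_combination h

/-- An invertible affine function of a vector of shares is a vector of shares. -/
theorem share_map_affine (L : ι → F) {c : F} (hc : IsUnit c) (x : F) :
    (share ι x).map (fun v i => L i + c * v i) = share ι (∑ i, L i + c * x) := by
  obtain ⟨c, rfl⟩ := hc
  let g : (ι → F) ≃ (ι → F) :=
    { toFun := fun v i => L i + c * v i
      invFun := fun w i => (c⁻¹ : Fˣ) * (w i - L i)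
      left_inv := fun v => by funext i; simp
      right_inv := fun w => by funext i; simp }
  refine share_map_equiv g fun v => ?_
  simp only [g, Equiv.coe_fn_mk, Finset.sum_add_distrib, ← Finset.mul_sum, add_right_inj,
    Units.mul_right_inj]

end Sharing

/-! ### Masked shares -/

section Mask

variable {F : Type} {ι : Type}

/-- The entries of a vector at the indices in `M`. -/
def mask (M : ι → Prop) [DecidablePred M] (v : ι → F) (i : ι) : Option F :=
  if M i then some (v i) else none

theorem share_map_mask [CommRing F] [Fintype F] [Fintype ι] [Nonempty ι] (M : ι → Prop)
    [DecidablePred M] {i : ι} (hi : ¬ M i) (x y : F) :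
    (share ι x).map (mask M) = (share ι y).map (mask M) := by
  refine share_map_eq x y i _ fun v w h => ?_
  funext j
  unfold mask
  split_ifs with hj
  · rw [h j]
    rintro rfl
    exact hi hj
  · rfl

end Mask

/-! ### The protocol and the simulator as sequences of independent draws -/

section Protocol

variable {F : Type} [CommRing F] [Fintype F] {n k : ℕ} [NeZero n] [NeZero k]
variable {P : Params F n k}

/-- The kernel functionality almost surely reconstructs the true inputs, so the kernel shares are
independent of the input shares. -/
theorem run_eq (P : Params F n k) (x : Fin n → F) : run P x =
    (indep fun e : P.E => indep fun j : Fin k => share (Fin k) (x (e.1 j))).bind fun a =>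
    (indep fun e : P.E => share (Fin k) (P.f fun j => x (e.1 j))).bind fun b =>
    (encodedNoise P.R P.ε P.δ P.s).bind fun η₀ => (share (Fin n) η₀).bind fun η =>
    PMF.pure { inputShare := a, kernelShare := b, noiseShare := η,
               message := aggMessage P b η } := by
  have h : run P x =
      (indep fun e : P.E => indep fun j : Fin k => share (Fin k) (x (e.1 j))).bind fun a =>
      (indep fun e : P.E => functionalityF P.f (fun l j => a e j l)).bind fun b =>
      ((encodedNoise P.R P.ε P.δ P.s).bind fun η₀ => share (Fin n) η₀).bind fun η =>
      PMF.pure { inputShare := a, kernelShare := b, noiseShare := η,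
                 message := aggMessage P b η } := rfl
  rw [h]
  refine bind_congr_support _ fun a ha => ?_
  have hf : ∀ e : P.E, functionalityF P.f (fun l j => a e j l) =
      share (Fin k) (P.f fun j => x (e.1 j)) := by
    intro e
    unfold functionalityF reconstruct
    congr 2
    funext j
    exact mem_support_share.1 (mem_support_indep.1 (mem_support_indep.1 ha e) j)
  simp only [hf, PMF.bind_bind]

theorem idealFunctionality_eq (P : Params F n k) (x : Fin n → F) : idealFunctionality P x =
    (encodedNoise P.R P.ε P.δ P.s).bind fun η =>
    PMF.pure (Ring.inverse P.card * (∑ e ∈ P.E, P.f fun j => x (e j)) + η) := rfl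

theorem simTranscript_eq (P : Params F n k) (c : Fin n → Option F) (u : Option F) :
    simTranscript P c u =
    (indep fun e : P.E => indep fun j : Fin k => orUniform (c (e.1 j))).bind fun x =>
    (indep fun e : P.E => indep fun j : Fin k => share (Fin k) (x e j)).bind fun a =>
    (indep fun e : P.E => orUniform
      (if ∀ j, (c (e.1 j)).isSome = true then some (P.f (x e)) else none)).bind fun y =>
    (indep fun e : P.E => share (Fin k) (y e)).bind fun b =>
    (orUniform (u.map fun v => v - Ring.inverse P.card * ∑ e : P.E, y e)).bind fun η₀ =>
    (share (Fin n) η₀).bind fun η =>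
    PMF.pure { inputShare := a, kernelShare := b, noiseShare := η,
               message := aggMessage P b η } := rfl

theorem sum_localSum (b : P.E → Fin k → F) : ∑ i, localSum P b i = ∑ e : P.E, ∑ l, b e l := by
  unfold localSum
  rw [Finset.sum_comm]
  refine Finset.sum_congr rfl fun e _ => ?_
  rw [Finset.sum_comm]
  simp

/-- The messages to the aggregator are uniform subject to their sum, given the kernel shares. -/
theorem share_bind_aggMessage {Γ : Type} (hcard : IsUnit P.card) (b : P.E → Fin k → F) (η₀ : F)
    (K : (Fin n → F) → PMF Γ) :
    ((share (Fin n) η₀).bind fun η => K (aggMessage P b η)) =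
      (share (Fin n) (∑ e : P.E, ∑ l, b e l + P.card * η₀)).bind K := by
  rw [← sum_localSum, ← share_map_affine _ hcard, PMF.bind_map]
  rfl

/-! ### Real and simulated views -/

namespace Adversary

/-- The shares of inputs that the adversary sees. -/
def maskInput (A : Adversary P) (e : P.E) (j : Fin k) : (Fin k → F) → Fin k → Option F :=
  mask fun l => e.1 j ∈ A.corrupted ∨ e.1 l ∈ A.corrupted

/-- The shares of kernel values that the adversary sees. -/
def maskKernel (A : Adversary P) (e : P.E) : (Fin k → F) → Fin k → Option F :=
  mask fun l => e.1 l ∈ A.corrupted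

/-- The view, computed from the visible shares of inputs and kernel values and the messages. -/
def viewOf (A : Adversary P) (c : Fin n → Option F) (a : P.E → Fin k → Fin k → Option F)
    (b : P.E → Fin k → Option F) (z : Fin n → F) : View P where
  input := c
  inputShare := a
  kernelShare := b
  noiseShare i := if i ∈ A.corrupted then
    some (Ring.inverse P.card * (z i - localSum P (fun e l => (b e l).getD 0) i)) else none
  message i := if A.aggregator = true ∨ i ∈ A.corrupted then some (z i) else none

/-- A corrupted party's noise share is `c⁻¹ (z_i - y_i)`, hence carries nothing beyond its message
and its kernel shares. -/
theorem view_eq_viewOf (A : Adversary P) (hcard : IsUnit P.card) (c : Fin n → Option F)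
    (a : P.E → Fin k → Fin k → F) (b : P.E → Fin k → F) (η : Fin n → F) :
    A.view c { inputShare := a, kernelShare := b, noiseShare := η,
               message := aggMessage P b η } =
      A.viewOf c (fun e j => A.maskInput e j (a e j)) (fun e => A.maskKernel e (b e))
        (aggMessage P b η) := by
  unfold view viewOf
  congr 1
  funext i
  dsimp only
  split_ifs with hi
  -- All kernel shares held by the corrupted party `i` are visible, so the default `0` never enters
  -- its sum.
  · have h : localSum P (fun e l => (A.maskKernel e (b e) l).getD 0) i = localSum P b i := by
      unfold localSum maskKernel mask
      refine Finset.sum_congr rfl fun e _ => Finset.sum_congr rfl fun l _ => ?_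
      split_ifs with h
      · subst h
        simp [hi]
      · rfl
    rw [h, aggMessage, add_sub_cancel_left, ← mul_assoc, Ring.inverse_mul_cancel _ hcard, one_mul]
  · rfl

theorem exists_notMem (A : Adversary P) : ∃ i, i ∉ A.corrupted := by
  by_contra! h
  have h1 : A.corrupted = Finset.univ := Finset.eq_univ_iff_forall.2 h
  have h2 := A.card_le
  rw [h1, Finset.card_univ, Fintype.card_fin] at h2
  have := NeZero.pos n
  omega

/-- The law of the visible shares of inputs. -/
def inputLaw (A : Adversary P) (x : Fin n → F) : PMF (P.E → Fin k → Fin k → Option F) :=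
  indep fun e : P.E => indep fun j => (share (Fin k) (x (e.1 j))).map (A.maskInput e j)

/-- The law of the visible shares of kernel values. -/
def kernelLaw (A : Adversary P) (x : Fin n → F) : PMF (P.E → Fin k → Option F) :=
  indep fun e : P.E => (share (Fin k) (P.f fun j => x (e.1 j))).map (A.maskKernel e)

/-- The law of the view on inputs `x`, given the output `u` of the aggregator. -/
def viewLaw (A : Adversary P) (x : Fin n → F) (u : F) : PMF (View P) :=
  (A.inputLaw x).bind fun a => (A.kernelLaw x).bind fun b =>
    (share (Fin n) (P.card * u)).map (A.viewOf (A.inputs x) a b)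

/-- For any kernel shares, the messages are a uniform sharing of `c u`. This decouples them from the
other shares and gives the law of output and view jointly, as an environment sees both. -/
theorem run_bind_output_view (A : Adversary P) (hcard : IsUnit P.card) (x : Fin n → F)
    {Γ : Type} (H : F → View P → PMF Γ) :
    ((run P x).bind fun T => H (output T) (A.view (A.inputs x) T)) =
      (idealFunctionality P x).bind fun u => (A.viewLaw x u).bind (H u) := by
  have key : ∀ (a : P.E → Fin k → Fin k → F),
      ∀ b ∈ (indep fun e : P.E => share (Fin k) (P.f fun j => x (e.1 j))).support, ∀ η₀ : F,
      ((share (Fin n) η₀).bind fun η =>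
        H (Ring.inverse P.card * reconstruct (aggMessage P b η))
          (A.viewOf (A.inputs x) (fun e j => A.maskInput e j (a e j))
            (fun e => A.maskKernel e (b e)) (aggMessage P b η))) =
      ((share (Fin n) (P.card * (Ring.inverse P.card * (∑ e ∈ P.E, P.f fun j => x (e j)) +
        η₀))).map (A.viewOf (A.inputs x) (fun e j => A.maskInput e j (a e j))
            (fun e => A.maskKernel e (b e)))).bind
        (H (Ring.inverse P.card * (∑ e ∈ P.E, P.f fun j => x (e j)) + η₀)) := by
    intro a b hb η₀
    have hsum : ∑ e : P.E, ∑ l, b e l = ∑ e ∈ P.E, P.f fun j => x (e j) := by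
      rw [← Finset.sum_coe_sort P.E]
      exact Finset.sum_congr rfl fun e _ => mem_support_share.1 (mem_support_indep.1 hb e)
    have hmul : ∑ e : P.E, ∑ l, b e l + P.card * η₀ =
        P.card * (Ring.inverse P.card * (∑ e ∈ P.E, P.f fun j => x (e j)) + η₀) := by
      rw [hsum, mul_add, Ring.mul_inverse_cancel_left _ _ hcard]
    rw [share_bind_aggMessage hcard b η₀ (fun z => H (Ring.inverse P.card * reconstruct z)
          (A.viewOf (A.inputs x) (fun e j => A.maskInput e j (a e j))
            (fun e => A.maskKernel e (b e)) z)), hmul, PMF.bind_map]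
    refine bind_congr_support _ fun z hz => ?_
    rw [reconstruct, mem_support_share.1 hz, Ring.inverse_mul_cancel_left _ _ hcard]
    rfl
  simp only [run_eq, PMF.bind_bind, PMF.pure_bind, A.view_eq_viewOf hcard, output]
  simp only [idealFunctionality_eq, PMF.bind_bind, PMF.pure_bind, viewLaw, inputLaw, kernelLaw,
    ← indep_map, PMF.bind_map, Function.comp_def]
  -- The noise is drawn first in the ideal execution and after the shares in the real one;
  -- independent draws commute.
  rw [PMF.bind_comm (encodedNoise P.R P.ε P.δ P.s)]
  refine congrArg _ (funext fun a => ?_)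
  rw [PMF.bind_comm (encodedNoise P.R P.ε P.δ P.s)]
  refine bind_congr_support _ fun b hb => congrArg _ (funext fun η₀ => ?_)
  exact (key a b hb η₀).trans (PMF.bind_map _ _ _)

/-- The messages and noise shares are simulated perfectly: without the aggregator, the adversary
misses at least one message. -/
theorem orUniform_bind_share_bind_viewOf (A : Adversary P) (hcard : IsUnit P.card)
    (c : Fin n → Option F) (u w : F) (a : P.E → Fin k → Fin k → Option F)
    (b : P.E → Fin k → Option F) {Γ : Type} (H : View P → PMF Γ) :
    ((orUniform ((if A.aggregator = true then some u else none).map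
        fun v => v - Ring.inverse P.card * w)).bind fun η₀ =>
      (share (Fin n) (w + P.card * η₀)).bind fun z => H (A.viewOf c a b z)) =
      ((share (Fin n) (P.card * u)).map (A.viewOf c a b)).bind H := by
  have hmap : ∀ t : F, ((share (Fin n) t).bind fun z => H (A.viewOf c a b z)) =
      ((share (Fin n) t).map (A.viewOf c a b)).bind H := fun t => (PMF.bind_map _ _ _).symm
  simp only [hmap]
  split_ifs with hA
  · change PMF.bind (PMF.pure _) _ = _
    rw [PMF.pure_bind, mul_sub, Ring.mul_inverse_cancel_left _ _ hcard, add_sub_cancel]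
  -- The message of an honest `i` is unseen, so the sum of the messages, and with it the noise
  -- value, does not matter.
  · obtain ⟨i, hi⟩ := A.exists_notMem
    have h : ∀ t : F, (share (Fin n) t).map (A.viewOf c a b) =
        (share (Fin n) (P.card * u)).map (A.viewOf c a b) := by
      refine fun t => share_map_eq t _ i _ fun v w hvw => ?_
      have hv : ∀ j ∈ A.corrupted, v j = w j := fun j hj =>
        hvw j (by rintro rfl; exact hi hj)
      unfold viewOf
      congr 1
      · funext j
        split_ifs with hj
        · rw [hv j hj]
        · rfl
      · funext j
        split_ifs with hj
        · rw [hv j (hj.resolve_left hA)]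
        · rfl
    simp only [h, PMF.bind_const]

/-- For a corrupted owner the shared value is the true one. An honest owner `j` keeps its own share,
index `l = j`, hidden. -/
theorem orUniform_bind_share_map_maskInput (A : Adversary P) (x : Fin n → F) (e : P.E)
    (j : Fin k) :
    ((orUniform (A.inputs x (e.1 j))).bind fun t => (share (Fin k) t).map (A.maskInput e j)) =
      (share (Fin k) (x (e.1 j))).map (A.maskInput e j) := by
  by_cases hj : e.1 j ∈ A.corrupted
  · simp only [inputs, if_pos hj, orUniform, Option.elim_some]
    exact PMF.pure_bind _ _
  · have h : ∀ t : F, (share (Fin k) t).map (A.maskInput e j) =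
        (share (Fin k) (x (e.1 j))).map (A.maskInput e j) := fun t =>
      share_map_mask _ (i := j) (by simpa using hj) _ _
    simp only [h, PMF.bind_const]

/-- On an edge not inside the corrupted set, the share of an honest member is hidden. -/
theorem orUniform_bind_share_map_maskKernel (A : Adversary P) (e : P.E) (v : F) :
    ((orUniform (if ∀ j, e.1 j ∈ A.corrupted then some v else none)).bind fun t =>
      (share (Fin k) t).map (A.maskKernel e)) = (share (Fin k) v).map (A.maskKernel e) := by
  split_ifs with h
  · exact PMF.pure_bind _ _
  · obtain ⟨j, hj⟩ := not_forall.1 h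
    have h : ∀ t : F, (share (Fin k) t).map (A.maskKernel e) =
        (share (Fin k) v).map (A.maskKernel e) := fun t => share_map_mask _ (i := j) hj _ _
    simp only [h, PMF.bind_const]

theorem simTranscript_bind_view (A : Adversary P) (hcard : IsUnit P.card) (x : Fin n → F)
    (u : F) {Γ : Type} (H : View P → PMF Γ) :
    ((simTranscript P (A.inputs x) (if A.aggregator = true then some u else none)).bind
      fun T => H (A.view (A.inputs x) T)) = (A.viewLaw x u).bind H := by
  let X := indep fun e : P.E => indep fun j : Fin k => orUniform (A.inputs x (e.1 j))
  -- On an edge inside the corrupted set, the simulated inputs are almost surely the true ones, so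
  -- the kernel value is too.
  have hX : ∀ x' ∈ X.support, ∀ e : P.E,
      orUniform (if ∀ j, (A.inputs x (e.1 j)).isSome = true then some (P.f (x' e)) else none) =
      orUniform (if ∀ j, e.1 j ∈ A.corrupted then some (P.f fun j => x (e.1 j)) else none) := by
    intro x' hx' e
    have hiff : ∀ j, (A.inputs x (e.1 j)).isSome = true ↔ e.1 j ∈ A.corrupted := by
      intro j
      unfold inputs
      split_ifs with hj <;> simp [hj]
    simp only [hiff]
    split_ifs with h
    · congr 3
      funext j
      have hj := mem_support_indep.1 (mem_support_indep.1 hx' e) j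
      rw [inputs, if_pos (h j)] at hj
      exact (PMF.mem_support_pure_iff _ _).1 hj
    · rfl
  have hinner : ∀ (a : P.E → Fin k → Fin k → F) (y : P.E → F),
      ∀ b ∈ (indep fun e : P.E => share (Fin k) (y e)).support,
      ((orUniform ((if A.aggregator = true then some u else none).map
          fun v => v - Ring.inverse P.card * ∑ e : P.E, y e)).bind fun η₀ =>
        (share (Fin n) η₀).bind fun η => H (A.viewOf (A.inputs x)
          (fun e j => A.maskInput e j (a e j)) (fun e => A.maskKernel e (b e))
          (aggMessage P b η))) =
      ((share (Fin n) (P.card * u)).map (A.viewOf (A.inputs x)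
          (fun e j => A.maskInput e j (a e j)) (fun e => A.maskKernel e (b e)))).bind H := by
    intro a y b hb
    rw [← A.orUniform_bind_share_bind_viewOf hcard _ u (∑ e : P.E, y e)]
    refine congrArg _ (funext fun η₀ => ?_)
    have hsum : ∑ e : P.E, ∑ l, b e l = ∑ e : P.E, y e :=
      Finset.sum_congr rfl fun e _ => mem_support_share.1 (mem_support_indep.1 hb e)
    rw [share_bind_aggMessage hcard b η₀ (fun z => H (A.viewOf (A.inputs x)
          (fun e j => A.maskInput e j (a e j)) (fun e => A.maskKernel e (b e)) z)), hsum]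
  simp only [simTranscript_eq, PMF.bind_bind, PMF.pure_bind, A.view_eq_viewOf hcard]
  calc _ = X.bind fun x' =>
        (indep fun e : P.E => indep fun j : Fin k => share (Fin k) (x' e j)).bind fun a =>
        (indep fun e : P.E => orUniform
          (if ∀ j, e.1 j ∈ A.corrupted then some (P.f fun j => x (e.1 j)) else none)).bind
          fun y => (indep fun e : P.E => share (Fin k) (y e)).bind fun b =>
        ((share (Fin n) (P.card * u)).map (A.viewOf (A.inputs x)
          (fun e j => A.maskInput e j (a e j)) (fun e => A.maskKernel e (b e)))).bind H := by
        refine bind_congr_support _ fun x' hx' => congrArg _ (funext fun a => ?_)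
        simp only [hX x' hx']
        exact congrArg _ (funext fun y => bind_congr_support _ fun b hb => hinner a y b hb)
    _ = (A.viewLaw x u).bind H := by
        -- What remains factors over the edges, and each dummy secret is averaged out separately.
        have h : ∀ e : P.E, (share (Fin k) (P.f fun j => x (e.1 j))).map (A.maskKernel e) = _ :=
          fun e => (A.orUniform_bind_share_map_maskKernel e _).symm
        simp only [viewLaw, inputLaw, kernelLaw, ← A.orUniform_bind_share_map_maskInput x, h,
          ← indep_bind, ← indep_map, PMF.bind_bind, PMF.bind_map, Function.comp_def, X]

theorem realExec_eq_idealExec (A : Adversary P) (hcard : IsUnit P.card)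
    (Z : Environment F n A.Out) : realExec A Z = idealExec A (simulator A) Z := by
  have h1 : realExec A Z = Z.init.bind fun z => (run P z.1).bind fun T =>
      (A.strategy (A.view (A.inputs z.1) T)).bind fun o => Z.guess z.2 (output T) o := rfl
  have h2 : idealExec A (simulator A) Z = Z.init.bind fun z =>
      (idealFunctionality P z.1).bind fun u =>
      ((simTranscript P (A.inputs z.1) (if A.aggregator = true then some u else none)).bind
        fun T => A.strategy (A.view (A.inputs z.1) T)).bind fun o => Z.guess z.2 u o := rfl
  rw [h1, h2]
  refine congrArg _ (funext fun z => ?_)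
  rw [A.run_bind_output_view hcard z.1
    fun u v => (A.strategy v).bind fun o => Z.guess z.2 u o]
  refine congrArg _ (funext fun u => ?_)
  rw [A.simTranscript_bind_view hcard z.1 u A.strategy, PMF.bind_bind]

end Adversary

/-- Special case of the joint law of output and view: nobody is corrupted and the view is discarded.
-/
theorem outputLaw_eq_idealFunctionality (hcard : IsUnit P.card) (x : Fin n → F) :
    outputLaw P x = idealFunctionality P x := by
  let A : Adversary P :=
    { corrupted := ∅
      card_le := by simp
      aggregator := false
      Out := Unit
      strategy := fun _ => PMF.pure () }
  have h := A.run_bind_output_view hcard x fun u _ => PMF.pure u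
  simp only [PMF.bind_const, PMF.bind_pure] at h
  exact h

end Protocol

/-! ### Additive noise mechanisms -/

/-- Off the bad set `B` the density ratio is at most `C`, and this integrates; all of `B` is charged
to the additive term. -/
theorem withDensity_shift_le {g : ℝ → ℝ≥0∞} (hg : Measurable g) {C : ℝ≥0∞} {d : ℝ} {B S : Set ℝ}
    (hB : MeasurableSet B) (hS : MeasurableSet S) (h : ∀ t ∉ B, g t ≤ C * g (t - d)) :
    (volume.withDensity g) S ≤
      C * (volume.withDensity g) ((fun t => t + d) ⁻¹' S) + (volume.withDensity g) B := by
  have h1 : (volume.withDensity g) (S \ B) ≤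
      C * (volume.withDensity g) ((fun t => t + d) ⁻¹' S) := by
    have hS' : MeasurableSet ((fun t : ℝ => t + d) ⁻¹' S) := hS.preimage (by fun_prop)
    have hmeas : Measurable fun t : ℝ => ((fun t : ℝ => t + d) ⁻¹' S).indicator g (t - d) :=
      (hg.indicator hS').comp (measurable_id.sub_const d)
    rw [withDensity_apply _ (hS.diff hB), withDensity_apply _ hS', ← lintegral_indicator hS',
      ← lintegral_sub_right_eq_self (((fun t : ℝ => t + d) ⁻¹' S).indicator g) d,
      ← lintegral_const_mul _ hmeas, ← lintegral_indicator (hS.diff hB)]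
    refine lintegral_mono fun t => ?_
    by_cases ht : t ∈ S \ B
    · rw [Set.indicator_of_mem ht, Set.indicator_of_mem (by simpa using ht.1)]
      exact h t ht.2
    · rw [Set.indicator_of_notMem ht]
      exact zero_le
  calc (volume.withDensity g) S ≤ (volume.withDensity g) (S \ B ∪ B) :=
        measure_mono (by rw [Set.sdiff_union_self]; exact Set.subset_union_left)
    _ ≤ _ := (measure_union_le _ _).trans (by gcongr)

/-- By the triangle inequality the density ratio is at most `exp (|d| / b)` everywhere, so the bad
set is empty. -/
theorem laplace_shift_le {b ε d : ℝ} (hb : 0 < b) (hd : |d| ≤ ε * b) {S : Set ℝ}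
    (hS : MeasurableSet S) :
    laplace b S ≤ ENNReal.ofReal (Real.exp ε) * laplace b ((fun t => t + d) ⁻¹' S) := by
  rw [laplace, if_pos hb]
  have h := withDensity_shift_le (d := d) (C := ENNReal.ofReal (Real.exp ε))
    (g := fun t => ENNReal.ofReal (Real.exp (-|t| / b) / (2 * b))) (by fun_prop)
    MeasurableSet.empty hS ?_
  · simpa using h
  · intro t _
    rw [← ENNReal.ofReal_mul (Real.exp_nonneg _), ← mul_div_assoc, ← Real.exp_add]
    refine ENNReal.ofReal_le_ofReal ?_
    gcongr
    have h1 : |t - d| ≤ |t| + |d| := abs_sub t d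
    rw [div_le_iff₀ hb, add_mul, div_mul_cancel₀ _ hb.ne']
    linarith

/-! ### Gaussian tails -/

theorem gaussianReal_preimage_neg (v : ℝ≥0) {S : Set ℝ} (hS : MeasurableSet S) :
    gaussianReal 0 v ((fun t => -t) ⁻¹' S) = gaussianReal 0 v S := by
  rw [← Measure.map_apply measurable_neg hS, gaussianReal_map_neg, neg_zero]

theorem gaussianReal_Ici_zero {v : ℝ≥0} (hv : v ≠ 0) :
    gaussianReal 0 v (Set.Ici 0) = ENNReal.ofReal (1 / 2) := by
  have := nullSingletonClass_gaussianReal (μ := 0) hv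
  have h1 : gaussianReal 0 v (Set.Iio 0) = gaussianReal 0 v (Set.Ici 0) := by
    rw [measure_congr Ioi_ae_eq_Ici.symm, ← gaussianReal_preimage_neg v measurableSet_Ioi]
    congr 1
    ext t
    simp
  have h2 : gaussianReal 0 v (Set.Iio 0) + gaussianReal 0 v (Set.Ici 0) = 1 := by
    rw [← measure_union (Set.Iio_disjoint_Ici le_rfl) measurableSet_Ici, Set.Iio_union_Ici,
      measure_univ]
  rw [h1, ← two_mul] at h2
  rw [ENNReal.eq_inv_of_mul_eq_one_left ((mul_comm _ _).trans h2)]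
  simp

/-- For `t, T ≥ 0`, `(t + T)² ≥ t² + T²`: the tail is at most the factor `exp (-T² / (2v))` times
the half-line mass `1 / 2`. -/
theorem gaussianReal_Ici_le {v : ℝ≥0} (hv : v ≠ 0) {T : ℝ} (hT : 0 ≤ T) :
    gaussianReal 0 v (Set.Ici T) ≤ ENNReal.ofReal (Real.exp (-(T ^ 2 / (2 * v))) / 2) := by
  have hv' : (0 : ℝ) < v := by exact_mod_cast pos_iff_ne_zero.2 hv
  calc gaussianReal 0 v (Set.Ici T) = ∫⁻ t, (Set.Ici T).indicator (gaussianPDF 0 v) (t + T) := by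
        rw [lintegral_add_right_eq_self, lintegral_indicator measurableSet_Ici,
          gaussianReal_apply 0 hv]
    _ ≤ ∫⁻ t, ENNReal.ofReal (Real.exp (-(T ^ 2 / (2 * v)))) *
          (Set.Ici 0).indicator (gaussianPDF 0 v) t := by
        refine lintegral_mono fun t => ?_
        by_cases ht : 0 ≤ t
        · rw [Set.indicator_of_mem (by simpa using ht), Set.indicator_of_mem (by simpa using ht),
            gaussianPDF, gaussianPDF, ← ENNReal.ofReal_mul (Real.exp_nonneg _)]
          refine ENNReal.ofReal_le_ofReal ?_
          rw [gaussianPDFReal, gaussianPDFReal, mul_left_comm, ← Real.exp_add]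
          gcongr
          rw [← neg_div, ← add_div]
          gcongr
          nlinarith [mul_nonneg ht hT]
        · rw [Set.indicator_of_notMem (by simpa using ht)]
          exact zero_le
    _ = ENNReal.ofReal (Real.exp (-(T ^ 2 / (2 * v))) / 2) := by
        rw [lintegral_const_mul _ ((measurable_gaussianPDF 0 v).indicator measurableSet_Ici),
          lintegral_indicator measurableSet_Ici, ← gaussianReal_apply 0 hv,
          gaussianReal_Ici_zero hv, ← ENNReal.ofReal_mul (Real.exp_nonneg _)]
        congr 1
        ring

/-- Half the mass, plus the length `r` times the crude density bound `1 / √v`. It serves the case of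
a negative tail threshold. -/
theorem gaussianReal_Ici_neg_le {v : ℝ≥0} (hv : v ≠ 0) {r : ℝ} (hr : 0 ≤ r) :
    gaussianReal 0 v (Set.Ici (-r)) ≤ ENNReal.ofReal (1 / 2 + r / √v) := by
  have hv' : (0 : ℝ) < v := by exact_mod_cast pos_iff_ne_zero.2 hv
  have hpdf : ∀ t, gaussianPDF 0 v t ≤ ENNReal.ofReal (1 / √v) := by
    intro t
    refine ENNReal.ofReal_le_ofReal ?_
    rw [gaussianPDFReal, one_div]
    have h1 : Real.exp (-(t - 0) ^ 2 / (2 * v)) ≤ 1 :=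
      Real.exp_le_one_iff.2 (div_nonpos_of_nonpos_of_nonneg (by nlinarith [sq_nonneg (t - 0)])
        (by positivity))
    have h2 : √(v : ℝ) ≤ √(2 * Real.pi * v) :=
      Real.sqrt_le_sqrt (by nlinarith [Real.pi_gt_three])
    have h3 : (√(2 * Real.pi * v))⁻¹ ≤ (√(v : ℝ))⁻¹ := inv_anti₀ (Real.sqrt_pos.2 hv') h2
    exact (mul_le_of_le_one_right (by positivity) h1).trans h3
  calc gaussianReal 0 v (Set.Ici (-r))
      ≤ gaussianReal 0 v (Set.Ici 0 ∪ Set.Ico (-r) 0) := by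
        refine measure_mono fun t ht => ?_
        by_cases h : 0 ≤ t
        · exact Or.inl h
        · exact Or.inr ⟨ht, not_le.1 h⟩
    _ ≤ gaussianReal 0 v (Set.Ici 0) + gaussianReal 0 v (Set.Ico (-r) 0) := measure_union_le _ _
    _ ≤ ENNReal.ofReal (1 / 2) + ENNReal.ofReal (r / √v) := by
        rw [gaussianReal_Ici_zero hv, gaussianReal_apply 0 hv]
        gcongr
        refine (lintegral_mono hpdf).trans ?_
        rw [lintegral_const, Measure.restrict_apply_univ, Real.volume_Ico, sub_neg_eq_add,
          zero_add, ← ENNReal.ofReal_mul (by positivity)]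
        refine ENNReal.ofReal_le_ofReal (le_of_eq ?_)
        ring
    _ = _ := (ENNReal.ofReal_add (by positivity) (by positivity)).symm

/-! ### The Gaussian mechanism -/

/-- The tail of the calibrated Gaussian beyond the point where the privacy loss exceeds `ε`. -/
theorem gaussianReal_tail_le {ε δ s : ℝ} (hε : 0 < ε) (hε1 : ε ≤ 1) (hδ : 0 < δ) (hδ1 : δ < 1)
    (hs : 0 < s) {v : ℝ≥0} (hv : (v : ℝ) = 2 * Real.log (1.25 / δ) * s ^ 2 / ε ^ 2) :
    gaussianReal 0 v (Set.Ici (v * ε / s - s / 2)) ≤ ENNReal.ofReal δ := by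
  obtain ⟨L, hL⟩ : ∃ L, L = Real.log (1.25 / δ) := ⟨_, rfl⟩
  rw [← hL] at hv
  have hδL : δ = 1.25 * Real.exp (-L) := by
    rw [hL, Real.exp_neg, Real.exp_log (by positivity)]
    field_simp
  -- From `log y ≥ 1 - 1 / y` at `y = 1.25 / δ`, with `δ < 1`.
  have hL0 : 0.2 ≤ L := by
    have h1 : 1 - (1.25 / δ)⁻¹ ≤ L := hL ▸ Real.one_sub_inv_le_log_of_pos (by positivity)
    have h2 : (1.25 / δ)⁻¹ = 0.8 * δ := by rw [inv_div]; ring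
    linarith
  have hL' : 0 < L := by linarith
  have hvpos : (0 : ℝ) < v := by rw [hv]; positivity
  have hv0 : v ≠ 0 := by rintro rfl; simp at hvpos
  have hT : (v : ℝ) * ε / s - s / 2 = s / ε * (2 * L - ε / 2) := by
    rw [hv]; field_simp
  rw [hT]
  rcases le_or_gt 0 (2 * L - ε / 2) with h | h
  · refine (gaussianReal_Ici_le hv0 (by positivity)).trans (ENNReal.ofReal_le_ofReal ?_)
    have h1 : (s / ε * (2 * L - ε / 2)) ^ 2 / (2 * v) = L - ε / 2 + ε ^ 2 / (16 * L) := by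
      rw [hv]; field_simp; ring
    have h2 : (0 : ℝ) ≤ ε ^ 2 / (16 * L) := by positivity
    have h3 : Real.exp (-(L - ε / 2 + ε ^ 2 / (16 * L))) ≤ Real.exp (-L) * Real.exp (1 / 2) := by
      rw [← Real.exp_add]
      exact Real.exp_le_exp.2 (by linarith)
    -- The constant `1.25` of the calibration together with the `1 / 2` of the tail bound leaves
    -- room for exactly `2.5`.
    have h4 : Real.exp (1 / 2) ≤ 2.5 := by
      have h5 : Real.exp (1 / 2) * Real.exp (1 / 2) = Real.exp 1 := by
        rw [← Real.exp_add]; norm_num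
      nlinarith [Real.exp_one_lt_d9, Real.exp_pos (1 / 2)]
    rw [h1, hδL]
    nlinarith [Real.exp_pos (-L)]
  -- Here `L < ε / 4 ≤ 1 / 4`, so `δ = 1.25 exp (-L)` is more than `0.9`, while the tail is at most
  -- `1 / 2 + 1 / 5`.
  · have h1 : s / ε * (2 * L - ε / 2) = -(s / ε * (ε / 2 - 2 * L)) := by ring
    rw [h1]
    refine (gaussianReal_Ici_neg_le hv0 (mul_nonneg (by positivity) (by linarith))).trans
      (ENNReal.ofReal_le_ofReal ?_)
    have h2 : s / ε * (1 / 2) ≤ √(v : ℝ) := by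
      refine Real.le_sqrt_of_sq_le ?_
      rw [hv, mul_pow, div_pow]
      have : (0 : ℝ) < s ^ 2 / ε ^ 2 := by positivity
      rw [mul_div_assoc]
      nlinarith
    have h3 : s / ε * (ε / 2 - 2 * L) / √(v : ℝ) ≤ 1 / 5 := by
      rw [div_le_iff₀ (Real.sqrt_pos.2 hvpos)]
      have : (0 : ℝ) < s / ε := by positivity
      nlinarith
    have h4 : 1 - L ≤ Real.exp (-L) := by linarith [Real.add_one_le_exp (-L)]
    linarith

theorem gaussianReal_shift_le {ε δ s d : ℝ} (hε : 0 < ε) (hε1 : ε ≤ 1) (hδ : 0 < δ) (hδ1 : δ < 1)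
    (hs : 0 < s) (hd : |d| ≤ s) {v : ℝ≥0}
    (hv : (v : ℝ) = 2 * Real.log (1.25 / δ) * s ^ 2 / ε ^ 2) {S : Set ℝ} (hS : MeasurableSet S) :
    gaussianReal 0 v S ≤
      ENNReal.ofReal (Real.exp ε) * gaussianReal 0 v ((fun t => t + d) ⁻¹' S) +
        ENNReal.ofReal δ := by
  have hvpos : (0 : ℝ) < v := by
    have : 0 < Real.log (1.25 / δ) := Real.log_pos (by rw [lt_div_iff₀ hδ]; linarith)
    rw [hv]; positivity
  have hv0 : v ≠ 0 := by rintro rfl; simp at hvpos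
  -- The log density ratio at `t` and `t - d` is `(d² - 2td) / (2v)`; the bad set is where it
  -- exceeds `ε`.
  have hB : MeasurableSet {t : ℝ | v * ε - d ^ 2 / 2 < -(t * d)} :=
    measurableSet_lt measurable_const (by fun_prop)
  have htail : gaussianReal 0 v {t : ℝ | v * ε - d ^ 2 / 2 < -(t * d)} ≤ ENNReal.ofReal δ := by
    refine le_trans ?_ (gaussianReal_tail_le hε hε1 hδ hδ1 hs hv)
    -- The threshold `vε / |d| - |d| / 2` decreases in `|d|`, so `|d| = s` is the worst case.
    have key : ∀ t : ℝ, v * ε - d ^ 2 / 2 < t * |d| → v * ε / s - s / 2 ≤ t := by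
      intro t ht
      have h0 : 0 < |d| := by
        rcases (abs_nonneg d).eq_or_lt with h | h
        · rw [← h, mul_zero, ← sq_abs, ← h] at ht
          nlinarith [mul_pos hvpos hε]
        · exact h
      have h1 : v * ε / |d| - |d| / 2 < t := by
        rw [← sq_abs] at ht
        rw [← mul_lt_mul_iff_left₀ h0]
        refine lt_of_eq_of_lt ?_ ht
        field_simp
      have h2 : v * ε / s ≤ v * ε / |d| := by gcongr
      linarith
    rcases le_total 0 d with h | h
    · rw [← gaussianReal_preimage_neg v measurableSet_Ici]
      refine measure_mono fun t ht => key (-t) ?_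
      rw [abs_of_nonneg h]
      simp only [Set.mem_ofPred_eq] at ht
      linarith
    · refine measure_mono fun t ht => key t ?_
      rw [abs_of_nonpos h]
      simp only [Set.mem_ofPred_eq] at ht
      linarith
  refine le_trans ?_ (add_le_add_right htail _)
  rw [gaussianReal_of_var_ne_zero 0 hv0]
  refine withDensity_shift_le (measurable_gaussianPDF 0 v) hB hS fun t ht => ?_
  simp only [Set.mem_ofPred_eq, not_lt] at ht
  rw [gaussianPDF, gaussianPDF, ← ENNReal.ofReal_mul (Real.exp_nonneg _)]
  refine ENNReal.ofReal_le_ofReal ?_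
  rw [gaussianPDFReal, gaussianPDFReal, mul_left_comm, ← Real.exp_add]
  gcongr
  rw [← sub_le_iff_le_add, ← sub_div, div_le_iff₀ (by positivity)]
  linarith

theorem noiseLaw_shift_le {ε δ s d : ℝ} (hε : 0 < ε) (hδ : 0 ≤ δ) (hε1 : 0 < δ → ε ≤ 1)
    (hd : |d| ≤ s) {S : Set ℝ} (hS : MeasurableSet S) :
    noiseLaw ε δ s S ≤
      ENNReal.ofReal (Real.exp ε) * noiseLaw ε δ s ((fun t => t + d) ⁻¹' S) +
        ENNReal.ofReal δ := by
  -- The degenerate noise laws are disposed of first: a nonpositive formal variance needs `δ > 1` or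
  -- `s = 0`, and a nonpositive Laplace scale forces `d = 0`.
  rcases le_or_gt 1 δ with hδ1 | hδ1
  · exact prob_le_one.trans ((ENNReal.one_le_ofReal.2 hδ1).trans le_add_self)
  rcases eq_or_ne d 0 with rfl | hd0
  · simp only [add_zero, Set.preimage_id']
    exact (le_mul_of_one_le_left zero_le
      (ENNReal.one_le_ofReal.2 (Real.one_le_exp hε.le))).trans le_self_add
  have hs : 0 < s := (abs_pos.2 hd0).trans_le hd
  rcases hδ.eq_or_lt with rfl | hδ0
  · rw [noiseLaw, if_pos rfl]
    refine (laplace_shift_le (by positivity) ?_ hS).trans le_self_add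
    rwa [mul_div_cancel₀ _ hε.ne']
  · rw [noiseLaw, if_neg hδ0.ne']
    refine gaussianReal_shift_le hε (hε1 hδ0) hδ0 hδ1 hs hd (Real.coe_toNNReal _ ?_) hS
    have : 0 ≤ Real.log (1.25 / δ) := Real.log_nonneg (by rw [le_div_iff₀ hδ0]; linarith)
    positivity

/-! ### Privacy of the output -/

theorem encodedNoise_toOuterMeasure {F : Type} (R : FixedPrecision F) (ε δ s : ℝ) (O : Set F) :
    (encodedNoise R ε δ s).toOuterMeasure O =
      noiseLaw ε δ s {t | R.ofInt (round (t / R.h)) ∈ O} := by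
  have : IsProbabilityMeasure ((noiseLaw ε δ s).map fun t => round (t / R.h)) :=
    Measure.isProbabilityMeasure_map (measurable_round_div R.h).aemeasurable
  have hO : MeasurableSet (R.ofInt ⁻¹' O) := MeasurableSet.of_discrete
  rw [encodedNoise, PMF.toOuterMeasure_map_apply, ← PMF.toMeasure_apply_eq_toOuterMeasure,
    Measure.toPMF_toMeasure, Measure.map_apply (measurable_round_div R.h) hO]
  rfl

/-- Finiteness of the domain makes the `sSup` a true supremum rather than the default value `0`. -/
theorem bddAbove_sensitivity {m : ℕ} {X : Type} [Finite X] (D : Set X) (g : (Fin m → X) → ℝ) :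
    BddAbove {r | ∃ x x' : Fin m → X, (∀ i, x i ∈ D) ∧ (∀ i, x' i ∈ D) ∧ Adjacent x x' ∧
      r = |g x - g x'|} := by
  refine (Set.Finite.subset (Set.finite_range
    fun p : (Fin m → X) × (Fin m → X) => |g p.1 - g p.2|) ?_).bddAbove
  rintro r ⟨x, x', -, -, -, rfl⟩
  exact ⟨(x, x'), rfl⟩

theorem abs_sub_le_sensitivity {m : ℕ} {X : Type} [Finite X] {D : Set X} (g : (Fin m → X) → ℝ)
    {x x' : Fin m → X} (hx : ∀ i, x i ∈ D) (hx' : ∀ i, x' i ∈ D) (h : Adjacent x x') :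
    |g x - g x'| ≤ sensitivity D g :=
  le_csSup (bddAbove_sensitivity D g) ⟨x, x', hx, hx', h, rfl⟩

theorem Adjacent.comp {m l : ℕ} {X : Type} {x x' : Fin m → X} (h : Adjacent x x')
    {e : Fin l → Fin m} (he : Function.Injective e) :
    Adjacent (fun j => x (e j)) (fun j => x' (e j)) := by
  rcases h with rfl | ⟨i, hi⟩
  · exact Or.inl rfl
  · by_cases hj : ∃ j, e j = i
    · obtain ⟨j, rfl⟩ := hj
      exact Or.inr ⟨j, fun j' h => hi _ (he.ne h)⟩
    · push Not at hj
      exact Or.inl (funext fun j => hi _ (hj j))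

section Protocol

variable {F : Type} [CommRing F] [Fintype F] {n k : ℕ} [NeZero n] [NeZero k]

/-- Each edge contains the changed party at most once, so every term of the average moves by at most
the kernel sensitivity. -/
theorem abs_uStat_sub_le (P : Params F n k) (hE : P.E.Nonempty) {D : Set F} {x x' : Fin n → F}
    (hx : ∀ i, x i ∈ D) (hx' : ∀ i, x' i ∈ D) (h : Adjacent x x') :
    |P.uStat x - P.uStat x'| ≤ sensitivity D P.kernel := by
  have hpos : (0 : ℝ) < P.E.card := by exact_mod_cast hE.card_pos
  rw [Params.uStat, Params.uStat, ← sub_div, abs_div, abs_of_pos hpos, div_le_iff₀ hpos,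
    ← Finset.sum_sub_distrib, mul_comm, ← nsmul_eq_mul]
  refine (Finset.abs_sum_le_sum_abs _ _).trans (Finset.sum_le_card_nsmul _ _ _ fun e _ => ?_)
  exact abs_sub_le_sensitivity P.kernel (fun j => hx _) (fun j => hx' _) (h.comp e.injective)

/-- Where the U-statistic is representable, the functionality releases its code in `F`. -/
theorem inverse_card_mul_sum_eq (P : Params F n k) (hE : P.E.Nonempty) (hcard : IsUnit P.card)
    (hconv : ∀ m : ℤ, P.R.ofInt m = (m : F)) (x : Fin n → F) {m : ℤ}
    (hm : P.uStat x = m * P.R.h) :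
    Ring.inverse P.card * (∑ e ∈ P.E, P.f fun j => x (e j)) = (m : F) := by
  have hpos : (0 : ℝ) < P.E.card := by exact_mod_cast hE.card_pos
  -- Cancelling `h` gives an identity in `ℤ`, which then maps to `F`; wrap-around is harmless
  -- because conversion is a ring map.
  have h1 : ∑ e ∈ P.E, P.R.toInt (P.f fun j => x (e j)) = P.E.card * m := by
    have h2 : P.R.h * ∑ e ∈ P.E, (P.R.toInt (P.f fun j => x (e j)) : ℝ) =
        P.R.h * (P.E.card * m) := by
      rw [Params.uStat, div_eq_iff hpos.ne'] at hm
      simp only [Params.kernel, FixedPrecision.value, ← Finset.mul_sum] at hm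
      linarith
    exact_mod_cast mul_left_cancel₀ P.R.h_pos.ne' h2
  have h3 : ∑ e ∈ P.E, P.f (fun j => x (e j)) = P.card * m := by
    calc ∑ e ∈ P.E, P.f (fun j => x (e j))
        = ((∑ e ∈ P.E, P.R.toInt (P.f fun j => x (e j)) : ℤ) : F) := by
          rw [Int.cast_sum]
          exact Finset.sum_congr rfl fun e _ => by rw [← hconv, P.R.ofInt_toInt]
      _ = P.card * m := by rw [h1, Int.cast_mul, Params.card, hconv]
  rw [h3, Ring.inverse_mul_cancel_left _ _ hcard]

/-- Adding the multiple `m h` before rounding equals adding `m` after it, so the noise in `F` acts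
like real noise on the real statistic. -/
theorem outputLaw_toOuterMeasure (P : Params F n k) (hE : P.E.Nonempty) (hcard : IsUnit P.card)
    (hconv : ∀ m : ℤ, P.R.ofInt m = (m : F)) (x : Fin n → F) {m : ℤ}
    (hm : P.uStat x = m * P.R.h) (O : Set F) :
    (outputLaw P x).toOuterMeasure O = noiseLaw P.ε P.δ P.s
      ((fun t => t + P.uStat x) ⁻¹' {t | (round (t / P.R.h) : F) ∈ O}) := by
  have h : idealFunctionality P x =
      (encodedNoise P.R P.ε P.δ P.s).map fun η => (m : F) + η := by
    rw [idealFunctionality_eq, inverse_card_mul_sum_eq P hE hcard hconv x hm]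
    rfl
  rw [outputLaw_eq_idealFunctionality hcard, h, PMF.toOuterMeasure_map_apply,
    encodedNoise_toOuterMeasure]
  congr 1
  ext t
  have hr : round ((t + P.uStat x) / P.R.h) = round (t / P.R.h) + m := by
    rw [hm, add_div, mul_div_cancel_right₀ _ P.R.h_pos.ne', round_add_intCast]
  simp only [Set.mem_preimage, Set.mem_ofPred_eq, hconv, hr, Int.cast_add, add_comm]

theorem isCentralDP_outputLaw (P : Params F n k) (hE : P.E.Nonempty) (hcard : IsUnit P.card)
    (hε : 0 < P.ε) (hδ : 0 ≤ P.δ) (D : Set F) (hconv : ∀ m : ℤ, P.R.ofInt m = (m : F))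
    (hint : ∀ x : Fin n → F, (∀ i, x i ∈ D) → ∃ m : ℤ, P.uStat x = m * P.R.h)
    (hs : sensitivity D P.kernel ≤ P.s ∨ sensitivity D P.uStat ≤ P.s)
    (hε1 : 0 < P.δ → P.ε ≤ 1) : IsCentralDP D (outputLaw P) P.ε P.δ := by
  intro x x' hx hx' hadj O
  obtain ⟨m, hm⟩ := hint x hx
  obtain ⟨m', hm'⟩ := hint x' hx'
  have hd : |P.uStat x - P.uStat x'| ≤ P.s := by
    rcases hs with h | h
    · exact (abs_uStat_sub_le P hE hx hx' hadj).trans h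
    · exact (abs_sub_le_sensitivity P.uStat hx hx' hadj).trans h
  have hS : MeasurableSet {t : ℝ | (round (t / P.R.h) : F) ∈ O} :=
    measurable_round_div P.R.h (MeasurableSet.of_discrete (s := {m : ℤ | (m : F) ∈ O}))
  rw [outputLaw_toOuterMeasure P hE hcard hconv x hm,
    outputLaw_toOuterMeasure P hE hcard hconv x' hm']
  have hS' : MeasurableSet ((fun t => t + P.uStat x) ⁻¹' {t | (round (t / P.R.h) : F) ∈ O}) :=
    hS.preimage (measurable_id.add_const (P.uStat x))
  -- Shifting by the difference turns translation by the statistic of `x` into translation by that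
  -- of `x'`.
  have h := noiseLaw_shift_le (d := P.uStat x' - P.uStat x) (s := P.s) hε hδ hε1
    (by rwa [abs_sub_comm]) hS'
  refine h.trans_eq ?_
  rw [← Set.preimage_comp]
  congr 3
  funext t
  simp

end Protocol

end

end UMPC

theorem mainTheorem5 {F : Type} [CommRing F] [Fintype F] {n k : ℕ} [NeZero n] [NeZero k]
    (P : UMPC.Params F n k) (hE : P.E.Nonempty) (hcard : IsUnit P.card)
    (hε : 0 < P.ε) (hδ : 0 ≤ P.δ) :
    -- perfect simulation against every static semi-honest adversary with at least one honest party
    (∀ (A : UMPC.Adversary P) (Z : UMPC.Environment F n A.Out),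
      UMPC.realExec A Z = UMPC.idealExec A (UMPC.simulator A) Z) ∧
    -- central differential privacy of the output
    (∀ D : Set F,
      -- integers are represented in `F` compatibly with their arithmetic
      (∀ m : ℤ, P.R.ofInt m = (m : F)) →
      -- the values of the U-statistic are representable at precision `h`
      (∀ x : Fin n → F, (∀ i, x i ∈ D) → ∃ m : ℤ, P.uStat x = m * P.R.h) →
      -- the noise is calibrated to the sensitivity of the kernel, or to that of the statistic
      (UMPC.sensitivity D P.kernel ≤ P.s ∨ UMPC.sensitivity D P.uStat ≤ P.s) →
      -- the range of the Gaussian mechanism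
      (0 < P.δ → P.ε ≤ 1) →
      UMPC.IsCentralDP D (UMPC.outputLaw P) P.ε P.δ) :=
  ⟨fun A Z => A.realExec_eq_idealExec hcard Z, fun D hconv hint hs hε1 =>
    UMPC.isCentralDP_outputLaw P hE hcard hε hδ D hconv hint hs hε1⟩
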